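/- Let $m,n\ge 0$ be integers and consider the channel $\mathbf y=\mathbf H\mathbf x+\mathbf z$, where the input $\mathbf x\in\mathbb C^m$, the noise $\mathbf z\in\mathbb C^n$ and the channel matrix $\mathbf H\in\mathbb C^{n\times m}$ are random and statistically independent, and the distributions of $\mathbf z$ and of $\mathbf H$ are fixed and have densities with respect to Lebesgue measure. The receiver knows $\mathbf H$, so the channel output is $(\mathbf y,\mathbf H)$. A complex random vector $\mathbf v$ is called circular if $e^{j2\pi\theta}\mathbf v$ has the same distribution as $\mathbf v$ for every $\theta\in[0,1)$; its circular analog is $\mathbf v_{(a)}=e^{j2\pi\psi}\mathbf v$ with $\psi$ uniformly distributed on $[0,1)$ and independent of $\mathbf v$. Let $\mathcal I$ be a set of probability distributions on $\mathbb C^m$ with densities (the admissible input distributions); write $\mathbf x\in\mathcal I$ if the distribution of $\mathbf x$ lies in $\mathcal I$. Assume that $\mathcal I$ is circular-closed, i.e. $\mathbf x\in\mathcal I$ implies $\mathbf x_{(a)}\in\mathcal I$. The coherent capacity is $$C_{\mathrm c}=\sup_{\mathbf x\in\mathcal I} I(\mathbf x;\mathbf y,\mathbf H)\in[0,\infty],$$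 where $I$ denotes mutual information, and $\mathbf x\in\mathcal I$ is said to achieve the coherent capacity if $I(\mathbf x;\mathbf y,\mathbf H)=C_{\mathrm c}$. Suppose that the random vector in $\mathbb C^{nm}$ obtained by stacking the entries of $\mathbf H$ in an arbitrary order is circular, and that some (not necessarily circular) $\mathbf x'\in\mathcal I$ achieves the coherent capacity. Then there exists a circular random vector $\mathbf x\in\mathcal I$ that achieves the coherent capacity. -/

import Mathlib

open MeasureTheory

noncomputable section

/-- The unit complex number `e^{j 2π θ}`. -/
def phase (θ : ℝ) : ℂ := Complex.exp (2 * Real.pi * θ * Complex.I)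

/-- A law `P` on `ℂ^ι` is circular: if `x` has law `P`, then `e^{j 2π θ} x` has law `P` for all
`θ ∈ [0,1)`. -/
def IsCircularLaw {ι : Type*} (P : Measure (ι → ℂ)) : Prop :=
  ∀ θ ∈ Set.Ico (0 : ℝ) 1, P.map (fun x => phase θ • x) = P

/-- The law of a complex random vector with a pdf: a probability measure that is absolutely
continuous with respect to Lebesgue measure (on `ℂ^ι = ℝ^{2ι}`). -/
def IsDensityLaw {ι : Type*} [Fintype ι] (P : Measure (ι → ℂ)) : Prop :=
  IsProbabilityMeasure P ∧ P ≪ volume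

/-- The law of the circular analog `e^{j 2π ψ} x` of a random vector `x` with law `P`, where
`ψ` is uniform on `[0,1)` and independent of `x`. -/
def circularAnalogLaw {ι : Type*} (P : Measure (ι → ℂ)) : Measure (ι → ℂ) :=
  (((volume : Measure ℝ).restrict (Set.Ico 0 1)).prod P).map (fun p => phase p.1 • p.2)

/-- A set of admissible input laws is circular-closed if it is closed under forming the
circular analog. -/
def CircularClosed {ι : Type*} (𝓘 : Set (Measure (ι → ℂ))) : Prop :=
  ∀ P ∈ 𝓘, circularAnalogLaw P ∈ 𝓘

/-- The product (Borel) `σ`-algebra on complex `n × m` matrices. -/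
instance complexMatrixMeasurableSpace {n m : ℕ} :
    MeasurableSpace (Matrix (Fin n) (Fin m) ℂ) :=
  inferInstanceAs (MeasurableSpace (Fin n → Fin m → ℂ))

/-- The stacking of the entries of an `n × m` matrix into a vector of length `n * m`, in the
order given by `σ`. -/
def stackMatrix {n m : ℕ} (σ : Fin (n * m) ≃ Fin n × Fin m)
    (H : Matrix (Fin n) (Fin m) ℂ) : Fin (n * m) → ℂ :=
  fun k => H (σ k).1 (σ k).2

/-- The mutual information (in nats, with values in `[0,∞]`) of a pair with joint law `J`: the
relative entropy of the joint law with respect to the product of its marginals. For laws with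
densities this is `∫ f(ξ,η) log (f(ξ,η) / (f₁(ξ) f₂(η)))`. -/
def mutualInformation {α β : Type*} [MeasurableSpace α] [MeasurableSpace β]
    (J : Measure (α × β)) : ENNReal :=
  InformationTheory.klDiv J ((J.map Prod.fst).prod (J.map Prod.snd))

/-- The joint law of the input `x` and the output `(H x + z, H)`, for independent `x`, `z`, `H`
with laws `Px`, `Pz`, `PH`. -/
def coherentJointLaw {n m : ℕ} (Pz : Measure (Fin n → ℂ))
    (PH : Measure (Matrix (Fin n) (Fin m) ℂ)) (Px : Measure (Fin m → ℂ)) :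
    Measure ((Fin m → ℂ) × ((Fin n → ℂ) × Matrix (Fin n) (Fin m) ℂ)) :=
  (Px.prod (Pz.prod PH)).map
    (fun p => (p.1, (Matrix.mulVec p.2.2 p.1 + p.2.1, p.2.2)))

/-- The mutual information `I(x; y, H)` with `y = H x + z`. -/
def coherentInformation {n m : ℕ} (Pz : Measure (Fin n → ℂ))
    (PH : Measure (Matrix (Fin n) (Fin m) ℂ)) (Px : Measure (Fin m → ℂ)) : ENNReal :=
  mutualInformation (coherentJointLaw Pz PH Px)

/-- The coherent capacity: the supremum of `I(x; y, H)` over the admissible input laws. -/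
def coherentCapacity {n m : ℕ} (Pz : Measure (Fin n → ℂ))
    (PH : Measure (Matrix (Fin n) (Fin m) ℂ)) (𝓘 : Set (Measure (Fin m → ℂ))) : ENNReal :=
  ⨆ Px ∈ 𝓘, coherentInformation Pz PH Px

/-- The input law `Px` is admissible and achieves the coherent capacity. -/
def AchievesCoherentCapacity {n m : ℕ} (Pz : Measure (Fin n → ℂ))
    (PH : Measure (Matrix (Fin n) (Fin m) ℂ)) (𝓘 : Set (Measure (Fin m → ℂ)))
    (Px : Measure (Fin m → ℂ)) : Prop :=
  Px ∈ 𝓘 ∧ coherentInformation Pz PH Px = coherentCapacity Pz PH 𝓘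

end

/-! Let `P` achieve capacity, let `Q` be its circular analog, `κ` the channel and `R` the output law
under `Q`. It suffices that `I(P) ≤ I(Q)`, since `Q` is circular and admissible. The output law of
`P` minimizes the divergence from products (`klDiv_compProd_prod_comp_le`), so `I(P) ≤ D(P ⊗ κ ‖ P ×
R)`. Now feed `e^{j2πψ} x` into the channel. Since `H(cx) = (cH)x`, rotating the observed `H` by `ψ`
and then forgetting `ψ` turns the joint law of `((ψ, x), (y, H))` into `P ⊗ κ`; it also turns `U × P
× R` into `P × R`, because `R` is invariant under rotations of `H`. Data processing bounds the
divergence by that of the pair with input `(ψ, x)`. The output depends on `(ψ, x)` only through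
`e^{j2πψ} x`, so `klDiv_compProd_comap_le` bounds this by `D(Q ⊗ κ ‖ Q × R) = I(Q)`. Nothing is
subtracted, so infinite values cause no trouble. -/

open ProbabilityTheory InformationTheory

/-! ### Divergence inequalities for Markov kernels -/

section Divergence

variable {Ω X Y N : Type*} [MeasurableSpace Ω] [MeasurableSpace X] [MeasurableSpace Y]
  [MeasurableSpace N]

/-- Pulling the input of a Markov kernel back along a map `f` does not increase the divergence of
the joint law from a product law. -/
theorem klDiv_compProd_comap_le [StandardBorelSpace Ω] [Nonempty Ω]
    (π : Measure Ω) [IsProbabilityMeasure π] {f : Ω → X} (hf : Measurable f)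
    (κ : Kernel X Y) [IsMarkovKernel κ] (R : Measure Y) [IsProbabilityMeasure R] :
    klDiv (π ⊗ₘ κ.comap f hf) (π.prod R) ≤ klDiv ((π.map f) ⊗ₘ κ) ((π.map f).prod R) := by
  have hF : Kernel.deterministic f hf ∘ₘ π = π.map f := Measure.deterministic_comp_eq_map hf
  have hQ : IsProbabilityMeasure (π.map f) := Measure.isProbabilityMeasure_map hf.aemeasurable
  have hpost : (π.map f) ⊗ₘ posterior (Kernel.deterministic f hf) π
      = π.map (fun ω => (f ω, ω)) := by
    rw [← hF, compProd_posterior_eq_map_swap, Measure.compProd_deterministic,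
      Measure.map_map measurable_swap (by fun_prop)]
    rfl
  set post := posterior (Kernel.deterministic f hf) π
  -- Keeping `y` and resampling `ω` from its conditional law given `f ω` restores the joint law. The
  -- resampling kernel does not depend on `η`, so it serves both `κ` and the constant kernel `R`,
  -- and data processing applies.
  have key (η : Kernel X Y) [IsMarkovKernel η] :
      (post ∥ₖ (Kernel.id : Kernel Y Y)) ∘ₘ ((π.map f) ⊗ₘ η) = π ⊗ₘ η.comap f hf := by
    refine Measure.ext_prod (fun {A B} hA hB => ?_)
    rw [Measure.bind_apply (hA.prod hB) (Kernel.aemeasurable _),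
      Measure.compProd_apply_prod hA hB,
      Measure.lintegral_compProd (Kernel.measurable_coe _ (hA.prod hB))]
    have h1 (x : X) : ∫⁻ y, (post ∥ₖ (Kernel.id : Kernel Y Y)) (x, y) (A ×ˢ B) ∂(η x)
        = ∫⁻ ω, A.indicator 1 ω * η x B ∂(post x) := by
      simp only [Kernel.parallelComp_apply, Measure.prod_prod, Kernel.id_apply,
        Measure.dirac_apply' _ hB]
      rw [lintegral_const_mul _ (measurable_one.indicator hB), lintegral_indicator_one hB,
        lintegral_mul_const _ (measurable_one.indicator hA), lintegral_indicator_one hA]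
    have hm : Measurable (fun p : X × Ω => A.indicator 1 p.2 * η p.1 B) :=
      (((measurable_one.indicator hA).comp measurable_snd).mul
        ((Kernel.measurable_coe η hB).comp measurable_fst) :)
    simp only [h1]
    rw [← Measure.lintegral_compProd (μ := π.map f) (κ := post) hm, hpost,
      lintegral_map hm (by fun_prop), ← lintegral_indicator hA]
    refine lintegral_congr fun ω => ?_
    by_cases h : ω ∈ A <;> simp [h, Kernel.comap_apply]
  have hR := key (Kernel.const X R)
  have hc : (Kernel.const X R).comap f hf = Kernel.const Ω R := rfl
  rw [hc, Measure.compProd_const, Measure.compProd_const] at hR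
  rw [← key κ, ← hR]
  exact klDiv_comp_right_le _ _ _

theorem klDiv_map_swap_eq (μ ν : Measure (X × Y)) [IsFiniteMeasure μ] [IsFiniteMeasure ν] :
    klDiv (μ.map Prod.swap) (ν.map Prod.swap) = klDiv μ ν := by
  refine le_antisymm (klDiv_map_le _ _ measurable_swap) ?_
  have h := klDiv_map_le (μ.map Prod.swap) (ν.map Prod.swap) (measurable_swap (α := Y) (β := X))
  simpa [Measure.map_map measurable_swap measurable_swap] using h

/-- The output law of a Markov kernel minimizes the divergence of the joint law from the products
with the input law. -/
theorem klDiv_compProd_prod_comp_le [StandardBorelSpace X] [Nonempty X]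
    (P : Measure X) [IsProbabilityMeasure P] (κ : Kernel X Y) [IsMarkovKernel κ]
    (R : Measure Y) [IsProbabilityMeasure R] :
    klDiv (P ⊗ₘ κ) (P.prod (κ ∘ₘ P)) ≤ klDiv (P ⊗ₘ κ) (P.prod R) := by
  -- Disintegrating along the output, the chain rule splits the right side as `D(κ ∘ₘ P ‖ R)` plus
  -- the left side.
  rw [← klDiv_map_swap_eq, ← klDiv_map_swap_eq (P ⊗ₘ κ) (P.prod R), Measure.prod_swap,
    Measure.prod_swap, ← compProd_posterior_eq_map_swap, ← Measure.compProd_const,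
    ← Measure.compProd_const, klDiv_compProd_eq_add (κ ∘ₘ P) R]
  exact le_add_self

/-- The kernel sending `x` to the law of `Ψ (x, ν)`, where `ν` is noise with law `M`. -/
noncomputable def noiseKernel (M : Measure N) [SFinite M] {Ψ : X × N → Y} (hΨ : Measurable Ψ) : Kernel X Y :=
  (Kernel.deterministic Ψ hΨ) ∘ₖ (Kernel.id ×ₖ Kernel.const X M)

instance (M : Measure N) [IsProbabilityMeasure M] {Ψ : X × N → Y} (hΨ : Measurable Ψ) :
    IsMarkovKernel (noiseKernel M hΨ) := by
  unfold noiseKernel; infer_instance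

theorem lintegral_noiseKernel (M : Measure N) [SFinite M] {Ψ : X × N → Y} (hΨ : Measurable Ψ)
    (x : X) {g : Y → ENNReal} (hg : Measurable g) :
    ∫⁻ y, g y ∂(noiseKernel M hΨ x) = ∫⁻ n, g (Ψ (x, n)) ∂M := by
  rw [noiseKernel, Kernel.lintegral_comp _ _ _ hg,
    Kernel.lintegral_id_prod (by fun_prop)]
  simp [Kernel.lintegral_deterministic' _ hg]

theorem compProd_noiseKernel (P : Measure Ω) [SFinite P] (M : Measure N) [IsProbabilityMeasure M]
    {Ψ : X × N → Y} (hΨ : Measurable Ψ) {f : Ω → X} (hf : Measurable f) :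
    P ⊗ₘ (noiseKernel M hΨ).comap f hf
      = (P.prod M).map (fun p => (p.1, Ψ (f p.1, p.2))) := by
  refine Measure.ext_of_lintegral _ fun g hg => ?_
  rw [Measure.lintegral_compProd hg, lintegral_map hg (by fun_prop),
    lintegral_prod _ (by fun_prop)]
  refine lintegral_congr fun ω => ?_
  rw [Kernel.comap_apply, lintegral_noiseKernel _ _ _ (by fun_prop)]

end Divergence

/-! ### Uniform phases and circular laws -/

theorem measurable_phase : Measurable phase := by
  unfold phase; fun_prop

theorem phase_add (a b : ℝ) : phase (a + b) = phase a * phase b := by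
  simp only [phase, ← Complex.exp_add]; push_cast; ring_nf

theorem phase_zero : phase 0 = 1 := by simp [phase]

theorem phase_eq_toCircle (θ : ℝ) : phase θ = AddCircle.toCircle (θ : AddCircle (1 : ℝ)) := by
  simp [phase, AddCircle.toCircle_apply_mk, Circle.coe_exp]

theorem phase_fract (θ : ℝ) : phase (Int.fract θ) = phase θ := by
  rw [phase_eq_toCircle, phase_eq_toCircle]
  congr 2
  rw [← sub_eq_zero, ← AddCircle.coe_sub, AddCircle.coe_eq_zero_iff]
  refine ⟨-⌊θ⌋, ?_⟩
  rw [← Int.self_sub_floor]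
  simp

/-- The right side does not involve `a`: every interval of length one covers the circle once. -/
theorem map_phase_restrict_Ioc (a : ℝ) :
    ((volume : Measure ℝ).restrict (Set.Ioc a (a + 1))).map phase
      = (volume : Measure (AddCircle (1 : ℝ))).map (fun t => (AddCircle.toCircle t : ℂ)) := by
  have hc : Measurable (fun t : AddCircle (1 : ℝ) => (AddCircle.toCircle t : ℂ)) :=
    (continuous_subtype_val.comp AddCircle.continuous_toCircle).measurable
  have h := AddCircle.measurePreserving_mk (1 : ℝ) a
  rw [← h.map_eq, Measure.map_map hc h.measurable]
  congr 1
  exact funext phase_eq_toCircle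

/-- The law of a uniformly distributed phase is invariant under rotations. -/
theorem map_phase_rotate (a : ℝ) :
    (((volume : Measure ℝ).restrict (Set.Ico 0 1)).map phase).map (fun c => phase a * c)
      = ((volume : Measure ℝ).restrict (Set.Ico 0 1)).map phase := by
  have h0 := map_phase_restrict_Ioc 0
  rw [zero_add] at h0
  rw [Measure.restrict_congr_set Ico_ae_eq_Ioc, h0]
  -- Rotation by `phase a` is translation of the unit interval by `a`.
  conv_rhs => rw [← map_phase_restrict_Ioc a]
  rw [← h0, Measure.map_map (by fun_prop) measurable_phase]
  have hp : MeasurePreserving (fun t : ℝ => a + t) (volume.restrict (Set.Ioc 0 1))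
      (volume.restrict (Set.Ioc a (a + 1))) := by
    have := (measurePreserving_add_left (volume : Measure ℝ) a).restrict_preimage
      (measurableSet_Ioc (a := a) (b := a + 1))
    simpa using this
  rw [← hp.map_eq, Measure.map_map measurable_phase hp.measurable]
  congr 1
  exact funext fun t => (phase_add a t).symm

theorem IsCircularLaw.map_phase_smul {ι : Type*} {P : Measure (ι → ℂ)} (h : IsCircularLaw P)
    (θ : ℝ) : P.map (fun x => phase θ • x) = P := by
  have := h (Int.fract θ) ⟨Int.fract_nonneg θ, Int.fract_lt_one θ⟩
  rwa [phase_fract] at this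

instance : IsProbabilityMeasure ((volume : Measure ℝ).restrict (Set.Ico 0 1)) :=
  ⟨by simp⟩

theorem measurable_smul_pi {α ι : Type*} [MeasurableSpace α] {c : α → ℂ} {x : α → ι → ℂ}
    (hc : Measurable c) (hx : Measurable x) : Measurable (fun a => c a • x a) :=
  measurable_pi_iff.2 fun i => hc.mul ((measurable_pi_apply i).comp hx)

theorem isCircularLaw_circularAnalogLaw {ι : Type*} (P : Measure (ι → ℂ)) [SFinite P] :
    IsCircularLaw (circularAnalogLaw P) := by
  intro a _
  have hs : Measurable (fun p : ℂ × (ι → ℂ) => p.1 • p.2) :=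
    measurable_smul_pi measurable_fst measurable_snd
  -- Written with a random unit scalar, the law lets an outer rotation be absorbed into that scalar.
  have hQ : circularAnalogLaw P = ((((volume : Measure ℝ).restrict (Set.Ico 0 1)).map phase).prod
      P).map (fun p => p.1 • p.2) := by
    conv_rhs => rw [← Measure.map_id (μ := P)]
    rw [Measure.map_prod_map _ _ measurable_phase measurable_id,
      Measure.map_map hs (measurable_phase.prodMap measurable_id)]
    rfl
  rw [hQ]
  conv_rhs => rw [← map_phase_rotate a, ← Measure.map_id (μ := P)]
  rw [Measure.map_prod_map _ _ (by fun_prop) measurable_id,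
    Measure.map_map hs (by fun_prop),
    Measure.map_map (g := fun x : ι → ℂ => phase a • x)
      (measurable_smul_pi measurable_const measurable_id) hs]
  congr 1
  exact funext fun p => smul_smul _ _ _

/-! ### Rotations and the coherent channel -/

section Channel

variable {n m : ℕ}

theorem measurable_matrix_iff {α : Type*} [MeasurableSpace α]
    {A : α → Matrix (Fin n) (Fin m) ℂ} :
    Measurable A ↔ ∀ i j, Measurable (fun a => A a i j) :=
  measurable_pi_iff.trans (forall_congr' fun _ => measurable_pi_iff)

theorem measurable_smul_matrix {α : Type*} [MeasurableSpace α] {c : α → ℂ}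
    {A : α → Matrix (Fin n) (Fin m) ℂ} (hc : Measurable c) (hA : Measurable A) :
    Measurable (fun a => c a • A a) :=
  measurable_matrix_iff.2 fun i j => hc.mul (measurable_matrix_iff.1 hA i j)

theorem measurable_stackMatrix (σ : Fin (n * m) ≃ Fin n × Fin m) : Measurable (stackMatrix σ) :=
  measurable_pi_iff.2 fun k => measurable_matrix_iff.1 measurable_id (σ k).1 (σ k).2

theorem map_phase_smul_of_stackMatrix {PH : Measure (Matrix (Fin n) (Fin m) ℂ)}
    {σ : Fin (n * m) ≃ Fin n × Fin m} (h : IsCircularLaw (PH.map (stackMatrix σ))) (θ : ℝ) :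
    PH.map (fun H => phase θ • H) = PH := by
  let u : (Fin (n * m) → ℂ) → Matrix (Fin n) (Fin m) ℂ := fun v => .of fun i j => v (σ.symm (i, j))
  have hu : Measurable u := measurable_matrix_iff.2 fun i j => measurable_pi_apply _
  have hus : u ∘ stackMatrix σ = id := by
    ext H i j
    simp [u, stackMatrix]
  have hs := measurable_stackMatrix σ
  have hsm : Measurable (fun v : Fin (n * m) → ℂ => phase θ • v) :=
    measurable_smul_pi measurable_const measurable_id
  have h1 := congrArg (Measure.map u) (h.map_phase_smul θ)
  rw [Measure.map_map hsm hs, Measure.map_map hu (hsm.comp hs), Measure.map_map hu hs, hus,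
    Measure.map_id] at h1
  refine Eq.trans ?_ h1
  congr 1
  ext H i j
  simp [u, stackMatrix]

/-- The channel `(x, (z, H)) ↦ (H x + z, H)`. -/
def channelMap (p : (Fin m → ℂ) × ((Fin n → ℂ) × Matrix (Fin n) (Fin m) ℂ)) :
    (Fin n → ℂ) × Matrix (Fin n) (Fin m) ℂ :=
  (Matrix.mulVec p.2.2 p.1 + p.2.1, p.2.2)

theorem measurable_channelMap : Measurable (channelMap (n := n) (m := m)) := by
  refine Measurable.prodMk (measurable_pi_iff.2 fun i => ?_) (measurable_snd.comp measurable_snd)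
  have hz : Measurable (fun p : (Fin m → ℂ) × ((Fin n → ℂ) × Matrix (Fin n) (Fin m) ℂ) =>
      p.2.1 i) := (measurable_pi_apply i).comp (measurable_fst.comp measurable_snd)
  have hHx : Measurable (fun p : (Fin m → ℂ) × ((Fin n → ℂ) × Matrix (Fin n) (Fin m) ℂ) =>
      ∑ j, p.2.2 i j * p.1 j) := by
    refine Finset.measurable_sum _ fun j _ => ?_
    exact (measurable_matrix_iff.1 (measurable_snd.comp measurable_snd) i j).mul
      ((measurable_pi_apply j).comp measurable_fst)
  exact hHx.add hz

/-- A rotation of the input can be moved to the channel matrix with the noise untouched, so `z` need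
not be circular. -/
theorem channelMap_smul (c : ℂ) (x : Fin m → ℂ) (z : Fin n → ℂ) (H : Matrix (Fin n) (Fin m) ℂ) :
    ((channelMap (c • x, (z, H))).1, c • (channelMap (c • x, (z, H))).2)
      = channelMap (x, (z, c • H)) := by
  simp [channelMap, Matrix.mulVec_smul, Matrix.smul_mulVec]

theorem coherentJointLaw_eq_compProd (Pz : Measure (Fin n → ℂ))
    (PH : Measure (Matrix (Fin n) (Fin m) ℂ)) (Px : Measure (Fin m → ℂ))
    [IsProbabilityMeasure Pz] [IsProbabilityMeasure PH] [IsProbabilityMeasure Px] :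
    coherentJointLaw Pz PH Px = Px ⊗ₘ noiseKernel (Pz.prod PH) measurable_channelMap :=
  (compProd_noiseKernel Px (Pz.prod PH) measurable_channelMap measurable_id).symm

theorem coherentInformation_eq_klDiv (Pz : Measure (Fin n → ℂ))
    (PH : Measure (Matrix (Fin n) (Fin m) ℂ)) (Px : Measure (Fin m → ℂ))
    [IsProbabilityMeasure Pz] [IsProbabilityMeasure PH] [IsProbabilityMeasure Px] :
    coherentInformation Pz PH Px
      = klDiv (Px ⊗ₘ noiseKernel (Pz.prod PH) measurable_channelMap)
        (Px.prod (noiseKernel (Pz.prod PH) measurable_channelMap ∘ₘ Px)) := by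
  rw [coherentInformation, mutualInformation, coherentJointLaw_eq_compProd]
  congr
  · exact Measure.fst_compProd _ _
  · exact Measure.snd_compProd _ _

theorem comp_noiseKernel_channelMap (Pz : Measure (Fin n → ℂ))
    (PH : Measure (Matrix (Fin n) (Fin m) ℂ)) (Px : Measure (Fin m → ℂ))
    [IsProbabilityMeasure Pz] [IsProbabilityMeasure PH] [IsProbabilityMeasure Px] :
    noiseKernel (Pz.prod PH) measurable_channelMap ∘ₘ Px
      = (Px.prod (Pz.prod PH)).map channelMap := by
  rw [← Measure.snd_compProd, ← coherentJointLaw_eq_compProd, Measure.snd]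
  exact Measure.map_map measurable_snd (measurable_fst.prodMk measurable_channelMap)

/-- For circular input and circular channel matrix, the law of the output `(y, H)` is invariant
under rotations of `H`. -/
theorem map_phase_smul_snd_output {Pz : Measure (Fin n → ℂ)}
    {PH : Measure (Matrix (Fin n) (Fin m) ℂ)} {Q : Measure (Fin m → ℂ)}
    [IsProbabilityMeasure Pz] [IsProbabilityMeasure PH] [IsProbabilityMeasure Q]
    (hPH : ∀ θ, PH.map (fun H => phase θ • H) = PH) (hQ : IsCircularLaw Q) (θ : ℝ) :
    ((Q.prod (Pz.prod PH)).map channelMap).map (fun w => (w.1, phase θ • w.2))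
      = (Q.prod (Pz.prod PH)).map channelMap := by
  -- Opposite rotations of `x` and `H` cancel in `H x`.
  have hx : MeasurePreserving (fun x : Fin m → ℂ => phase (-θ) • x) Q Q :=
    ⟨measurable_smul_pi measurable_const measurable_id, hQ.map_phase_smul _⟩
  have hH : MeasurePreserving (fun H => phase θ • H) PH PH :=
    ⟨measurable_smul_matrix measurable_const measurable_id, hPH θ⟩
  have hp := hx.prod ((MeasurePreserving.id Pz).prod hH)
  have hr : Measurable (fun w : (Fin n → ℂ) × Matrix (Fin n) (Fin m) ℂ =>
      (w.1, phase θ • w.2)) :=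
    measurable_fst.prodMk (measurable_smul_matrix measurable_const measurable_snd)
  conv_rhs => rw [← hp.map_eq]
  rw [Measure.map_map hr measurable_channelMap, Measure.map_map measurable_channelMap hp.measurable]
  congr 1
  funext p
  have hphase : phase θ • phase (-θ) • p.1 = p.1 := by
    rw [smul_smul, ← phase_add, add_neg_cancel, phase_zero, one_smul]
  have h := channelMap_smul (phase θ) (phase (-θ) • p.1) p.2.1 p.2.2
  rw [hphase] at h
  exact h

/-- Passing to the circular analog of the input does not decrease the mutual information. -/
theorem coherentInformation_le_circularAnalogLaw (Pz : Measure (Fin n → ℂ))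
    (PH : Measure (Matrix (Fin n) (Fin m) ℂ)) (P : Measure (Fin m → ℂ))
    [IsProbabilityMeasure Pz] [IsProbabilityMeasure PH] [IsProbabilityMeasure P]
    (hPH : ∀ θ, PH.map (fun H => phase θ • H) = PH) :
    coherentInformation Pz PH P ≤ coherentInformation Pz PH (circularAnalogLaw P) := by
  have hf : Measurable (fun p : ℝ × (Fin m → ℂ) => phase p.1 • p.2) :=
    measurable_smul_pi (measurable_phase.comp measurable_fst) measurable_snd
  have hQ : IsProbabilityMeasure (circularAnalogLaw P) :=
    Measure.isProbabilityMeasure_map hf.aemeasurable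
  have hcirc := isCircularLaw_circularAnalogLaw P
  rw [coherentInformation_eq_klDiv, coherentInformation_eq_klDiv]
  set κ := noiseKernel (Pz.prod PH) (measurable_channelMap (n := n) (m := m)) with hκ
  set R := κ ∘ₘ circularAnalogLaw P with hR
  set U := (volume : Measure ℝ).restrict (Set.Ico 0 1)
  have hRinv (θ : ℝ) : R.map (fun w => (w.1, phase θ • w.2)) = R := by
    rw [hR, hκ, comp_noiseKernel_channelMap]
    exact map_phase_smul_snd_output hPH hcirc θ
  -- Moves the phase from the input onto the observed matrix, then forgets it.
  let G : (ℝ × (Fin m → ℂ)) × ((Fin n → ℂ) × Matrix (Fin n) (Fin m) ℂ) →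
      (Fin m → ℂ) × ((Fin n → ℂ) × Matrix (Fin n) (Fin m) ℂ) :=
    fun p => (p.1.2, (p.2.1, phase p.1.1 • p.2.2))
  have hG : Measurable G := by
    refine (measurable_snd.comp measurable_fst).prodMk
      ((measurable_fst.comp measurable_snd).prodMk (measurable_smul_matrix ?_ ?_))
    · exact measurable_phase.comp (measurable_fst.comp measurable_fst)
    · exact measurable_snd.comp measurable_snd
  -- For fixed `(ψ, x)` the rotation preserves `M`, so this is a skew product. It is needed for the
  -- output law `R` and for `Pz.prod PH`.
  have hGM (M : Measure ((Fin n → ℂ) × Matrix (Fin n) (Fin m) ℂ)) [IsProbabilityMeasure M]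
      (hM : ∀ θ, M.map (fun w => (w.1, phase θ • w.2)) = M) :
      ((U.prod P).prod M).map G = P.prod M := by
    have hskew : MeasurePreserving (fun p : (ℝ × (Fin m → ℂ)) × _ =>
        (p.1, (p.2.1, phase p.1.1 • p.2.2))) ((U.prod P).prod M) ((U.prod P).prod M) :=
      (MeasurePreserving.id (U.prod P)).skew_product
        (g := fun a (w : (Fin n → ℂ) × Matrix (Fin n) (Fin m) ℂ) => (w.1, phase a.1 • w.2))
        (measurable_snd.comp hG)
        (Filter.Eventually.of_forall fun a => hM a.1)
    have hsnd : MeasurePreserving (Prod.snd : ℝ × (Fin m → ℂ) → _) (U.prod P) P :=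
      measurePreserving_snd
    exact ((hsnd.prod (MeasurePreserving.id M)).comp hskew).map_eq
  have hN (θ : ℝ) : (Pz.prod PH).map (fun w => (w.1, phase θ • w.2)) = Pz.prod PH :=
    ((MeasurePreserving.id Pz).prod
      ⟨measurable_smul_matrix measurable_const measurable_id, hPH θ⟩).map_eq
  have hJ : ((U.prod P) ⊗ₘ κ.comap _ hf).map G = P ⊗ₘ κ := by
    have hΦ : Measurable (fun p : (Fin m → ℂ) × ((Fin n → ℂ) × Matrix (Fin n) (Fin m) ℂ) =>
        (p.1, channelMap p)) := measurable_fst.prodMk measurable_channelMap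
    have hPκ : P ⊗ₘ κ = (P.prod (Pz.prod PH)).map (fun p => (p.1, channelMap p)) :=
      compProd_noiseKernel P (Pz.prod PH) measurable_channelMap measurable_id
    rw [hPκ, hκ, compProd_noiseKernel, ← hGM (Pz.prod PH) hN, Measure.map_map hΦ hG]
    refine (Measure.map_map hG (measurable_fst.prodMk (measurable_channelMap.comp
        ((hf.comp measurable_fst).prodMk measurable_snd)))).trans ?_
    congr 1
    funext p
    exact congrArg (Prod.mk p.1.2) (channelMap_smul (phase p.1.1) p.1.2 p.2.1 p.2.2)
  calc klDiv (P ⊗ₘ κ) (P.prod (κ ∘ₘ P))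
      ≤ klDiv (P ⊗ₘ κ) (P.prod R) := klDiv_compProd_prod_comp_le P κ R
    _ = klDiv (((U.prod P) ⊗ₘ κ.comap _ hf).map G) (((U.prod P).prod R).map G) := by
        rw [hJ, hGM R hRinv]
    _ ≤ klDiv ((U.prod P) ⊗ₘ κ.comap _ hf) ((U.prod P).prod R) := klDiv_map_le _ _ hG
    _ ≤ klDiv (circularAnalogLaw P ⊗ₘ κ) ((circularAnalogLaw P).prod R) :=
        klDiv_compProd_comap_le (U.prod P) hf κ R

end Channel

/-! ### Existence of a circular capacity-achieving input -/

theorem mainTheorem9 (n m : ℕ)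
    (Pz : Measure (Fin n → ℂ)) (hz : IsDensityLaw Pz)
    (PH : Measure (Matrix (Fin n) (Fin m) ℂ))
    (σ : Fin (n * m) ≃ Fin n × Fin m)
    (hH : IsDensityLaw (PH.map (stackMatrix σ)))
    (hHcirc : IsCircularLaw (PH.map (stackMatrix σ)))
    (𝓘 : Set (Measure (Fin m → ℂ)))
    (h𝓘 : ∀ P ∈ 𝓘, IsDensityLaw P)
    (hclosed : CircularClosed 𝓘)
    (hattained : ∃ P, AchievesCoherentCapacity Pz PH 𝓘 P) :
    ∃ P, IsCircularLaw P ∧ AchievesCoherentCapacity Pz PH 𝓘 P := by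
  obtain ⟨P, hP, hPC⟩ := hattained
  have hzp := hz.1
  have hPp := (h𝓘 P hP).1
  have hPHp : IsProbabilityMeasure PH := by
    have := hH.1
    exact Measure.isProbabilityMeasure_of_map (stackMatrix σ)
  have hle := coherentInformation_le_circularAnalogLaw Pz PH P
    (map_phase_smul_of_stackMatrix hHcirc)
  refine ⟨circularAnalogLaw P, isCircularLaw_circularAnalogLaw P, hclosed P hP, le_antisymm ?_ ?_⟩
  · exact le_iSup₂ (f := fun Px _ => coherentInformation Pz PH Px) _ (hclosed P hP)
  · exact hPC ▸ hle
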